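/- For $\sigma>0$ let $B_\sigma^\infty$ be the space of bounded functions $f\in C^\infty(\mathbb{R})$, $f:\mathbb{R}\to\mathbb{C}$, whose distributional Fourier transform (with kernel $e^{-ix\xi}$) has support in $[-\sigma,\sigma]$. Let $\operatorname{sinc}x=\frac{\sin \pi x}{\pi x}$ for $x\neq 0$ and $\operatorname{sinc}0=1$. For $m\ge 1$ and $k\in\mathbb{Z}$ put $$A_{m,k}=(-1)^{k+1}\operatorname{sinc}^{(2m-1)}\left(\tfrac12-k\right),\qquad B_{m,k}=(-1)^{k+1}\operatorname{sinc}^{(2m)}(-k)\ (k\neq 0),\qquad B_{m,0}=(-1)^{m+1}\frac{\pi^{2m}}{2m+1}.$$ **Theorem.** For each integer $m\ge1$, $\frac{A_{m,k}}{k-1/2}=O(|k|^{-3})$ and $\frac{B_{m,k}}{k}=O(|k|^{-3})$ as $|k|\to\infty$. For every $\sigma>0$, every $f\in B_\sigma^\infty$, every integer $m\ge 1$ and every $t\in\mathbb{R}$, the following formulas hold, and both series converge absolutely: $$f^{(2m)}(t)=(-1)^m\sigma^{2m}f(t)+\frac{2m\,\sigma^{2m}}{\pi^{2m}}\sum_{k\in\mathbb{Z}}(-1)^{k+1}\frac{A_{m,k}}{k-1/2}\,f\left(t+\frac{\pi}{\sigma}\left(k-\tfrac12\right)\right),$$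 $$f^{(2m+1)}(t)=-\frac{(2m+1)\sigma^{2m}}{\pi^{2m}}B_{m,0}\,f'(t)+\frac{(2m+1)\sigma^{2m+1}}{\pi^{2m+1}}\sum_{k\in\mathbb{Z}\setminus\{0\}}(-1)^{k+1}\frac{B_{m,k}}{k}\,f\left(t+\frac{\pi k}{\sigma}\right).$$ -/

import Mathlib

open MeasureTheory Filter Asymptotics SchwartzMap FourierTransform
open scoped ENNReal ContDiff

/-- The Bernstein space `B_σ^p`: all smooth `f : ℝ → ℂ` in `L^p(ℝ)` whose distributional Fourier
transform is supported in `[-σ, σ]` with respect to the kernel `e^{-i x ξ}`. Mathlib's `𝓕` uses the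
kernel `e^{-2 π i x ξ}`, so in its frequency variable this interval is `[-σ/(2π), σ/(2π)]`; the
support condition says that `𝓕 f` annihilates all test functions supported off that interval. -/
def BernsteinSpace (p : ℝ≥0∞) [Fact (1 ≤ p)] (σ : ℝ) : Set (ℝ → ℂ) :=
  {f | ContDiff ℝ ∞ f ∧ ∃ hf : MemLp f p volume,
    Distribution.IsVanishingOn
      (𝓕 (Lp.toTemperedDistribution (hf.toLp f) : 𝓢'(ℝ, ℂ)) : 𝓢'(ℝ, ℂ))
      (Set.Icc (-(σ / (2 * Real.pi))) (σ / (2 * Real.pi)))ᶜ}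

/-- The normalized cardinal sine: `sin (π x) / (π x)` for `x ≠ 0`, and `1` at `0`. -/
noncomputable def normalizedSinc (x : ℝ) : ℝ := Real.sinc (Real.pi * x)

/-- `A_{m,k} = (-1)^{k+1} sinc^{(2m-1)}(1/2 - k)`, for `m ≥ 1` and `k ∈ ℤ`. -/
noncomputable def coeffA (m : ℕ) (k : ℤ) : ℝ :=
  (-1) ^ (k + 1) * iteratedDeriv (2 * m - 1) normalizedSinc (1 / 2 - (k : ℝ))

/-- `B_{m,k} = (-1)^{k+1} sinc^{(2m)}(-k)` for `m ≥ 1` and `k ≠ 0`, and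
`B_{m,0} = (-1)^{m+1} π^{2m} / (2m+1)`. -/
noncomputable def coeffB (m : ℕ) (k : ℤ) : ℝ :=
  if k = 0 then (-1) ^ (m + 1) * (Real.pi ^ (2 * m) / (2 * (m : ℝ) + 1))
  else (-1) ^ (k + 1) * iteratedDeriv (2 * m) normalizedSinc (-(k : ℝ))

/-! Rescaled to the band `|v| ≤ 1/2`, differentiation multiplies by `2πiv` and translation by `r`
multiplies by `e^{2πivr}`. Both formulas are thus expansions in exponentials, on this band, of
`(2πiv)^(2m) - b` and `(2πiv)^(2m+1) - b(2πiv)`, with `b = (-1)^m π^(2m)`. This `b` makes both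
polynomials vanish at `±1/2`, so each extends to a continuous periodic function, even after a twist
by `e^{πiv}` that shifts the frequencies to `k - 1/2`. The Fourier coefficients are derivatives of
sinc at the nodes; `mul_iteratedDeriv_normalizedSinc_add` identifies them with the `A` and `B` terms
and gives their cubic decay, hence absolute convergence (`hasSum_exp_of_endpoints_eq_zero`).

The expansion passes to `f` by duality. It holds for `𝓕 χ` when the test function `χ` lives on the
band, and `f = f * 𝓕 χ` when `χ = 1` near the spectrum of `f` (`eq_integral_mul_fourier_sub`). Both
demands on `χ` are compatible only if the spectrum lies strictly inside the band, so the formula is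
proved for bands `τ > σ`, and then `τ ↓ σ`. -/

/-! ### Derivatives of sinc and their decay -/

/-- The normalized cardinal sine is the Fourier transform of the indicator function of
`(-1/2, 1/2]`. -/
theorem fourier_indicator_Ioc_eq_normalizedSinc (x : ℝ) :
    𝓕 ((Set.Ioc (-(1 / 2) : ℝ) (1 / 2)).indicator (fun _ => (1 : ℂ))) x =
      (normalizedSinc x : ℂ) := by
  rw [Real.fourier_real_eq_integral_exp_smul]
  have h1 : ∀ v : ℝ, Complex.exp (↑(-2 * Real.pi * v * x) * Complex.I) •
      (Set.Ioc (-(1 / 2) : ℝ) (1 / 2)).indicator (fun _ => (1 : ℂ)) v =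
      (Set.Ioc (-(1 / 2) : ℝ) (1 / 2)).indicator
        (fun v : ℝ => Complex.exp (-(2 * Real.pi * x * Complex.I) * v)) v := by
    intro v
    by_cases hv : v ∈ Set.Ioc (-(1 / 2) : ℝ) (1 / 2)
    · rw [Set.indicator_of_mem hv, Set.indicator_of_mem hv, smul_eq_mul, mul_one]
      congr 1
      push_cast
      ring
    · rw [Set.indicator_of_notMem hv, Set.indicator_of_notMem hv, smul_zero]
  simp_rw [h1]
  rw [integral_indicator measurableSet_Ioc, ← intervalIntegral.integral_of_le (by norm_num)]
  by_cases hx : x = 0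
  · subst hx
    norm_num [normalizedSinc]
  · have hpx : Real.pi * x ≠ 0 := mul_ne_zero Real.pi_ne_zero hx
    have hc : -(2 * Real.pi * x * Complex.I) ≠ 0 := by
      have : (Real.pi : ℂ) ≠ 0 := by exact_mod_cast Real.pi_ne_zero
      have : (x : ℂ) ≠ 0 := by exact_mod_cast hx
      simp_all
    rw [integral_exp_mul_complex hc, normalizedSinc, Real.sinc_of_ne_zero hpx]
    push_cast
    rw [Complex.sin, div_eq_div_iff hc (by exact_mod_cast hpx)]
    have e1 : -(2 * (Real.pi : ℂ) * x * Complex.I) * (1 / 2) = -(Real.pi * x) * Complex.I := by ring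
    have e2 : -(2 * (Real.pi : ℂ) * x * Complex.I) * (-(1 / 2)) = (Real.pi * x) * Complex.I := by
      ring
    rw [e1, e2]
    linear_combination (Complex.exp (-(Real.pi * x) * Complex.I) -
      Complex.exp (Real.pi * x * Complex.I)) * (Real.pi * x) * Complex.I_sq

theorem integrable_pow_smul_indicator_Ioc (n : ℕ) : Integrable (fun x : ℝ =>
    x ^ n • (Set.Ioc (-(1 / 2) : ℝ) (1 / 2)).indicator (fun _ => (1 : ℂ)) x) := by
  have : (fun x : ℝ => x ^ n • (Set.Ioc (-(1 / 2) : ℝ) (1 / 2)).indicator (fun _ => (1 : ℂ)) x) =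
      (Set.Ioc (-(1 / 2) : ℝ) (1 / 2)).indicator (fun x : ℝ => x ^ n • (1 : ℂ)) := by
    ext v
    by_cases hv : v ∈ Set.Ioc (-(1 / 2) : ℝ) (1 / 2)
    · simp only [Set.indicator_of_mem hv]
    · simp only [Set.indicator_of_notMem hv, smul_zero]
  rw [this, integrable_indicator_iff measurableSet_Ioc]
  exact (Continuous.continuousOn (by fun_prop)).integrableOn_Icc.mono_set Set.Ioc_subset_Icc_self

theorem ofReal_comp_normalizedSinc : (fun x : ℝ => (normalizedSinc x : ℂ)) =
    𝓕 ((Set.Ioc (-(1 / 2) : ℝ) (1 / 2)).indicator (fun _ => (1 : ℂ))) :=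
  funext fun x => (fourier_indicator_Ioc_eq_normalizedSinc x).symm

theorem contDiff_normalizedSinc : ContDiff ℝ ∞ normalizedSinc := by
  have h : ContDiff ℝ ∞ (fun x : ℝ => (normalizedSinc x : ℂ)) := by
    rw [ofReal_comp_normalizedSinc]
    refine Real.contDiff_fourier (N := ⊤) fun n _ => ?_
    simpa [norm_smul] using (integrable_pow_smul_indicator_Ioc n).norm
  exact (Complex.reCLM.contDiff (n := ∞)).comp h

theorem iteratedDeriv_ofReal_comp {g : ℝ → ℝ} (hg : ContDiff ℝ ∞ g) (n : ℕ) :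
    iteratedDeriv n (fun x : ℝ => (g x : ℂ)) = fun x : ℝ => ((iteratedDeriv n g x : ℝ) : ℂ) := by
  induction n with
  | zero => simp
  | succ n ih =>
    rw [iteratedDeriv_succ, ih]
    ext x
    rw [iteratedDeriv_succ]
    exact ((hg.differentiable_iteratedDeriv n (by exact_mod_cast WithTop.coe_lt_top _)) x).hasDerivAt.ofReal_comp.deriv

/-- The derivatives of the normalized cardinal sine as Fourier integrals. -/
theorem iteratedDeriv_normalizedSinc (n : ℕ) (x : ℝ) :
    ((iteratedDeriv n normalizedSinc x : ℝ) : ℂ) = ∫ v in (-(1 / 2) : ℝ)..(1 / 2),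
      (2 * Real.pi * Complex.I * v) ^ n * Complex.exp (2 * Real.pi * Complex.I * v * x) := by
  rw [← congrFun (iteratedDeriv_ofReal_comp contDiff_normalizedSinc n) x,
    ofReal_comp_normalizedSinc,
    Real.iteratedDeriv_fourier (N := ⊤) (fun n _ => integrable_pow_smul_indicator_Ioc n) le_top,
    Real.fourier_real_eq_integral_exp_smul]
  have h1 : ∀ v : ℝ, Complex.exp (↑(-2 * Real.pi * v * x) * Complex.I) •
      (-2 * (Real.pi : ℂ) * Complex.I * v) ^ n •
      (Set.Ioc (-(1 / 2) : ℝ) (1 / 2)).indicator (fun _ => (1 : ℂ)) v =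
      (Set.Ioc (-(1 / 2) : ℝ) (1 / 2)).indicator
        (fun v : ℝ => (2 * Real.pi * Complex.I * (-v : ℝ)) ^ n *
          Complex.exp (2 * Real.pi * Complex.I * (-v : ℝ) * x)) v := by
    intro v
    by_cases hv : v ∈ Set.Ioc (-(1 / 2) : ℝ) (1 / 2)
    · rw [Set.indicator_of_mem hv, Set.indicator_of_mem hv, smul_eq_mul, smul_eq_mul, mul_one,
        mul_comm]
      congr 2 <;> (push_cast; ring)
    · rw [Set.indicator_of_notMem hv, Set.indicator_of_notMem hv, smul_zero, smul_zero]
  simp_rw [h1]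
  rw [integral_indicator measurableSet_Ioc, ← intervalIntegral.integral_of_le (by norm_num),
    intervalIntegral.integral_comp_neg (fun v : ℝ => (2 * Real.pi * Complex.I * v) ^ n *
      Complex.exp (2 * Real.pi * Complex.I * v * x)), neg_neg]

theorem norm_exp_two_pi_I_mul (v x : ℝ) :
    ‖Complex.exp (2 * Real.pi * Complex.I * v * x)‖ = 1 := by
  have : 2 * (Real.pi : ℂ) * Complex.I * v * x = ((2 * Real.pi * v * x : ℝ) : ℂ) * Complex.I := by
    push_cast; ring
  rw [this, Complex.norm_exp_ofReal_mul_I]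

theorem abs_iteratedDeriv_normalizedSinc_le (n : ℕ) (x : ℝ) :
    |iteratedDeriv n normalizedSinc x| ≤ Real.pi ^ n := by
  rw [← Real.norm_eq_abs, ← Complex.norm_real, iteratedDeriv_normalizedSinc]
  refine (intervalIntegral.norm_integral_le_of_norm_le_const (C := Real.pi ^ n) ?_).trans ?_
  · intro v hv
    rw [Set.uIoc_of_le (by norm_num)] at hv
    rw [norm_mul, norm_exp_two_pi_I_mul, mul_one, norm_pow]
    refine pow_le_pow_left₀ (norm_nonneg _) ?_ n
    have hv' : |v| ≤ 1 / 2 := abs_le.2 ⟨hv.1.le, hv.2⟩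
    simp only [norm_mul, Complex.norm_real, Complex.norm_I, Complex.norm_ofNat, Real.norm_eq_abs,
      abs_of_pos Real.pi_pos]
    nlinarith [Real.pi_pos]
  · norm_num

theorem hasDerivAt_iteratedDeriv_normalizedSinc (n : ℕ) (x : ℝ) :
    HasDerivAt (iteratedDeriv n normalizedSinc) (iteratedDeriv (n + 1) normalizedSinc x) x := by
  rw [iteratedDeriv_succ]
  exact ((contDiff_normalizedSinc.differentiable_iteratedDeriv n
    (by exact_mod_cast WithTop.coe_lt_top _)) x).hasDerivAt

theorem mul_normalizedSinc (x : ℝ) : x * normalizedSinc x = Real.sin (Real.pi * x) / Real.pi := by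
  by_cases hx : x = 0
  · simp [hx]
  · rw [normalizedSinc, Real.sinc_of_ne_zero (mul_ne_zero Real.pi_ne_zero hx)]
    field_simp

/-- The identity `x sinc^{(n)}(x) + n sinc^{(n-1)}(x) = (sin (π x) / π)^{(n)}`. -/
theorem mul_iteratedDeriv_normalizedSinc_add (n : ℕ) : ∀ x : ℝ,
    x * iteratedDeriv n normalizedSinc x + n * iteratedDeriv (n - 1) normalizedSinc x =
      Real.pi ^ n / Real.pi * Real.sin (Real.pi * x + n * (Real.pi / 2)) := by
  induction n with
  | zero =>
    intro x
    simp only [iteratedDeriv_zero, mul_normalizedSinc]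
    simp
    ring
  | succ n ih =>
    intro x
    have hl : HasDerivAt (fun x => x * iteratedDeriv n normalizedSinc x +
        n * iteratedDeriv (n - 1) normalizedSinc x)
        (1 * iteratedDeriv n normalizedSinc x + x * iteratedDeriv (n + 1) normalizedSinc x +
          n * iteratedDeriv n normalizedSinc x) x := by
      refine ((hasDerivAt_id x).mul (hasDerivAt_iteratedDeriv_normalizedSinc n x)).add ?_
      -- For `n = 0` the truncated index `n - 1` is harmless: its factor `n` vanishes.
      rcases n with _ | n
      · simpa using hasDerivAt_const x (0 : ℝ)
      · exact (hasDerivAt_iteratedDeriv_normalizedSinc n x).const_mul _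
    have hr : HasDerivAt (fun x => Real.pi ^ n / Real.pi *
        Real.sin (Real.pi * x + n * (Real.pi / 2))) (Real.pi ^ n / Real.pi *
        (Real.cos (Real.pi * x + n * (Real.pi / 2)) * (Real.pi * 1))) x :=
      ((((hasDerivAt_id x).const_mul Real.pi).add_const _).sin).const_mul _
    rw [funext ih] at hl
    have := hl.unique hr
    have hs : Real.sin (Real.pi * x + ((n + 1 : ℕ) : ℝ) * (Real.pi / 2)) =
        Real.cos (Real.pi * x + n * (Real.pi / 2)) := by
      rw [← Real.sin_add_pi_div_two]
      congr 1
      push_cast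
      ring
    rw [hs, Nat.add_sub_cancel, pow_succ]
    push_cast
    linear_combination this

theorem abs_mul_iteratedDeriv_normalizedSinc_le (n : ℕ) (x : ℝ) :
    |x| * |iteratedDeriv n normalizedSinc x| ≤ Real.pi ^ n / Real.pi + n * Real.pi ^ (n - 1) := by
  rw [← abs_mul, eq_sub_of_add_eq (mul_iteratedDeriv_normalizedSinc_add n x)]
  refine (abs_sub _ _).trans (add_le_add ?_ ?_)
  · rw [abs_mul, abs_of_nonneg (by positivity : 0 ≤ Real.pi ^ n / Real.pi)]
    exact mul_le_of_le_one_right (by positivity) (Real.abs_sin_le_one _)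
  · rw [abs_mul, Nat.abs_cast]
    exact mul_le_mul_of_nonneg_left (abs_iteratedDeriv_normalizedSinc_le _ _) (by positivity)

/-- Quadratic decay of `sinc^{(n)}` at the zeros of `(sin (π x))^{(n)}`. -/
theorem exists_sq_mul_iteratedDeriv_normalizedSinc_le (n : ℕ) : ∃ C : ℝ, 0 ≤ C ∧ ∀ x : ℝ,
    Real.sin (Real.pi * x + n * (Real.pi / 2)) = 0 →
    |x| ^ 2 * |iteratedDeriv n normalizedSinc x| ≤ C := by
  -- At such a zero the identity reads `x sinc^{(n)}(x) = -n sinc^{(n-1)}(x)`, so the constant is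
  -- `n` times the first-order decay bound for `sinc^{(n-1)}`.
  refine ⟨n * (Real.pi ^ (n - 1) / Real.pi + (n - 1 : ℕ) * Real.pi ^ (n - 1 - 1)), by positivity,
    fun x hx => ?_⟩
  have h := mul_iteratedDeriv_normalizedSinc_add n x
  rw [hx, mul_zero] at h
  have h2 : |x| * |iteratedDeriv n normalizedSinc x| =
      n * |iteratedDeriv (n - 1) normalizedSinc x| := by
    rw [← abs_mul, eq_neg_of_add_eq_zero_left h, abs_neg, abs_mul, Nat.abs_cast]
  rw [pow_two, mul_assoc, h2, mul_left_comm]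
  exact mul_le_mul_of_nonneg_left (abs_mul_iteratedDeriv_normalizedSinc_le _ _) (by positivity)

/-! ### Size of the coefficients -/

theorem abs_neg_one_zpow_mul (k : ℤ) (x : ℝ) : |(-1 : ℝ) ^ k * x| = |x| := by
  rw [abs_mul, abs_zpow, abs_neg, abs_one, one_zpow, one_mul]

theorem neg_one_zpow_mul_self (k : ℤ) : (-1 : ℝ) ^ k * (-1 : ℝ) ^ k = 1 := by
  rw [← zpow_add₀ (by norm_num), ← two_mul, zpow_mul]
  norm_num

theorem coeffA_div_isBigO {m : ℕ} (hm : 1 ≤ m) :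
    (fun k : ℤ => coeffA m k / ((k : ℝ) - 1 / 2)) =O[cofinite]
      (fun k : ℤ => (|(k : ℝ)| ^ 3)⁻¹) := by
  obtain ⟨C, hC0, hC⟩ := exists_sq_mul_iteratedDeriv_normalizedSinc_le (2 * m - 1)
  -- The 8 is the cube of the 2 in `|k| ≤ 2 |k - 1/2|`, valid for `k ≠ 0`.
  refine IsBigO.of_bound (8 * C) ?_
  filter_upwards [(Set.finite_singleton (0 : ℤ)).compl_mem_cofinite] with k hk
  have hk1 : (1 : ℝ) ≤ |(k : ℝ)| := by exact_mod_cast Int.one_le_abs hk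
  have hr : |(k : ℝ)| / 2 ≤ |(k : ℝ) - 1 / 2| := by
    have h := abs_sub_abs_le_abs_sub (k : ℝ) (1 / 2)
    rw [abs_of_pos (by norm_num : (0 : ℝ) < 1 / 2)] at h
    linarith
  -- The half-integer nodes are the zeros needed for quadratic decay: the phase is `(m - k)π`.
  have hz : Real.sin (Real.pi * (1 / 2 - k) + ((2 * m - 1 : ℕ) : ℝ) * (Real.pi / 2)) = 0 := by
    rw [Real.sin_eq_zero_iff]
    refine ⟨m - k, ?_⟩
    rw [Nat.cast_sub (by omega)]
    push_cast
    ring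
  have h := hC _ hz
  rw [Real.norm_eq_abs, abs_div, coeffA, abs_neg_one_zpow_mul, norm_inv, norm_pow,
    Real.norm_eq_abs, abs_abs, ← div_eq_mul_inv]
  rw [abs_sub_comm] at hr ⊢
  have h0 : 0 < |1 / 2 - (k : ℝ)| := by linarith
  have hk0 : 0 < |(k : ℝ)| := by linarith
  rw [div_le_div_iff₀ h0 (by positivity)]
  have h3 : |(k : ℝ)| ^ 3 ≤ 8 * |1 / 2 - (k : ℝ)| ^ 3 := by
    have := pow_le_pow_left₀ (by positivity) hr 3
    rw [div_pow] at this
    linarith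
  calc _ ≤ |iteratedDeriv (2 * m - 1) normalizedSinc (1 / 2 - k)| *
        (8 * |1 / 2 - (k : ℝ)| ^ 3) := by gcongr
    _ = 8 * (|1 / 2 - (k : ℝ)| ^ 2 * |iteratedDeriv (2 * m - 1) normalizedSinc (1 / 2 - k)|) *
        |1 / 2 - (k : ℝ)| := by ring
    _ ≤ _ := by gcongr

theorem coeffB_div_isBigO (m : ℕ) :
    (fun k : ℤ => coeffB m k / (k : ℝ)) =O[cofinite] (fun k : ℤ => (|(k : ℝ)| ^ 3)⁻¹) := by
  obtain ⟨C, hC0, hC⟩ := exists_sq_mul_iteratedDeriv_normalizedSinc_le (2 * m)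
  refine IsBigO.of_bound C ?_
  filter_upwards [(Set.finite_singleton (0 : ℤ)).compl_mem_cofinite] with k hk
  have hk0 : 0 < |(k : ℝ)| := abs_pos.2 (by exact_mod_cast hk)
  have hz : Real.sin (Real.pi * (-k) + ((2 * m : ℕ) : ℝ) * (Real.pi / 2)) = 0 := by
    rw [Real.sin_eq_zero_iff]
    refine ⟨m - k, ?_⟩
    push_cast
    ring
  have h := hC _ hz
  rw [Real.norm_eq_abs, abs_div, coeffB, if_neg (by simpa using hk), abs_neg_one_zpow_mul, norm_inv,
    norm_pow, Real.norm_eq_abs, abs_abs, ← div_eq_mul_inv, div_le_div_iff₀ hk0 (by positivity)]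
  rw [abs_neg] at h
  calc _ = |(k : ℝ)| ^ 2 * |iteratedDeriv (2 * m) normalizedSinc (-k)| * |(k : ℝ)| := by ring
    _ ≤ _ := by gcongr

theorem summable_of_isBigO_inv_abs_cube {d : ℤ → ℝ}
    (h : d =O[cofinite] (fun k : ℤ => (|(k : ℝ)| ^ 3)⁻¹)) : Summable d := by
  refine summable_of_isBigO ?_ h
  have := (Real.summable_one_div_int_pow (p := 3)).2 (by norm_num)
  simpa using this.abs

/-! ### Fourier series of the multipliers on the band -/

theorem exp_two_pi_I_mul_pow_integral_sub (n j : ℕ) (b x : ℝ) :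
    ∫ v in (-(1 / 2) : ℝ)..(1 / 2), ((2 * Real.pi * Complex.I * v) ^ n -
      b * (2 * Real.pi * Complex.I * v) ^ j) * Complex.exp (2 * Real.pi * Complex.I * v * x) =
    ((iteratedDeriv n normalizedSinc x - b * iteratedDeriv j normalizedSinc x : ℝ) : ℂ) := by
  push_cast
  rw [iteratedDeriv_normalizedSinc, iteratedDeriv_normalizedSinc,
    ← intervalIntegral.integral_const_mul, ← intervalIntegral.integral_sub]
  · congr 1
    ext v
    ring
  · exact (Continuous.intervalIntegrable (by fun_prop) _ _)
  · exact (Continuous.intervalIntegrable (by fun_prop) _ _)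

/-- Fourier expansion of `(2πiv)^n - b (2πiv)^j` on `[-1/2, 1/2]` along the frequencies `k - δ`,
when this polynomial vanishes at both end points. -/
theorem hasSum_exp_of_endpoints_eq_zero {n j : ℕ} {b δ : ℝ} {d : ℤ → ℝ} (hd : Summable d)
    (hcoeff : ∀ k : ℤ, d k = iteratedDeriv n normalizedSinc (-((k : ℝ) - δ)) -
      b * iteratedDeriv j normalizedSinc (-((k : ℝ) - δ)))
    (h₁ : (Real.pi * Complex.I) ^ n = b * (Real.pi * Complex.I) ^ j)
    (h₂ : (-(Real.pi * Complex.I)) ^ n = b * (-(Real.pi * Complex.I)) ^ j)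
    {v : ℝ} (hv : |v| ≤ 1 / 2) :
    HasSum (fun k : ℤ => (d k : ℂ) * Complex.exp (2 * Real.pi * Complex.I * v * ((k : ℝ) - δ : ℝ)))
      ((2 * Real.pi * Complex.I * v) ^ n - b * (2 * Real.pi * Complex.I * v) ^ j) := by
  -- The twist by `e^{2πivδ}` turns the frequencies `k - δ` into integers. It need not be 1-periodic
  -- itself, but the polynomial factor kills both end points, so `H` still is continuous on the
  -- circle.
  let H : ℝ → ℂ := fun v => ((2 * Real.pi * Complex.I * v) ^ n -
    b * (2 * Real.pi * Complex.I * v) ^ j) * Complex.exp (2 * Real.pi * Complex.I * v * δ)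
  have hHl : H (-(1 / 2)) = 0 := by
    have : 2 * (Real.pi : ℂ) * Complex.I * ((-(1 / 2) : ℝ) : ℂ) = -(Real.pi * Complex.I) := by
      push_cast; ring
    simp only [H, this, h₂, sub_self, zero_mul]
  have hHr : H (1 / 2) = 0 := by
    have : 2 * (Real.pi : ℂ) * Complex.I * ((1 / 2 : ℝ) : ℂ) = Real.pi * Complex.I := by
      push_cast; ring
    simp only [H, this, h₁, sub_self, zero_mul]
  have hone : (-(1 / 2) : ℝ) + 1 = 1 / 2 := by norm_num
  have hHc : Continuous (AddCircle.liftIco 1 (-(1 / 2)) H) :=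
    AddCircle.liftIco_continuous (by rw [hone, hHl, hHr])
      (Continuous.continuousOn (by fun_prop))
  let F : C(AddCircle (1 : ℝ), ℂ) := ⟨_, hHc⟩
  have hF : ∀ k, fourierCoeff F k = (d k : ℂ) := by
    intro k
    change fourierCoeff (AddCircle.liftIco 1 (-(1 / 2)) H) k = _
    rw [fourierCoeff_liftIco_eq, fourierCoeffOn_eq_integral, hcoeff,
      ← exp_two_pi_I_mul_pow_integral_sub]
    simp only [hone]
    norm_num only [one_smul, sub_neg_eq_add]
    refine intervalIntegral.integral_congr fun v _ => ?_
    simp only [fourier_coe_apply, smul_eq_mul, H]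
    rw [mul_left_comm, ← Complex.exp_add]
    congr 2
    push_cast
    ring
  have hFs : Summable (fourierCoeff F) := by
    rw [funext hF]
    exact Complex.ofRealCLM.summable hd
  have hval : F (v : AddCircle (1 : ℝ)) = H v := by
    -- The fundamental domain is half-open, so `v = 1/2` has to be read as `-1/2`.
    rcases eq_or_lt_of_le (abs_le.1 hv).2 with h | h
    · have : (v : AddCircle (1 : ℝ)) = ((-(1 / 2) : ℝ) : AddCircle (1 : ℝ)) := by
        rw [h, ← AddCircle.coe_add_period (1 : ℝ) (-(1 / 2)), hone]
      rw [this, h, hHr, ← hHl]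
      exact AddCircle.liftIco_coe_apply (f := H) ⟨le_rfl, by norm_num⟩
    · exact AddCircle.liftIco_coe_apply (f := H) ⟨(abs_le.1 hv).1, by rwa [hone]⟩
  have := (has_pointwise_sum_fourier_series_of_summable hFs v).mul_right
    (Complex.exp (-(2 * Real.pi * Complex.I * v * δ)))
  rw [hval] at this
  convert! this using 1
  · ext k
    rw [hF, fourier_coe_apply, smul_eq_mul, mul_assoc (d k : ℂ), ← Complex.exp_add]
    congr 2
    push_cast
    ring
  · simp only [H]
    rw [mul_assoc (_ - _), ← Complex.exp_add, add_neg_cancel, Complex.exp_zero, mul_one]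

theorem sin_add_two_mul_pi_div_two (m : ℕ) (x : ℝ) :
    Real.sin (x + (2 * m : ℕ) * (Real.pi / 2)) = (-1) ^ m * Real.sin x := by
  rw [← Real.sin_add_nat_mul_pi]
  congr 1
  push_cast
  ring

/-- In the identity of order `2m` minus `(-1)^m π^(2m)` times that of order 0, the sines cancel;
what remains is divided by the node. -/
theorem coeffA_term_eq (m : ℕ) (k : ℤ) :
    2 * (m : ℝ) * ((-1) ^ (k + 1) * (coeffA m k / ((k : ℝ) - 1 / 2))) =
      iteratedDeriv (2 * m) normalizedSinc (-((k : ℝ) - 1 / 2)) -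
        (-1) ^ m * Real.pi ^ (2 * m) * iteratedDeriv 0 normalizedSinc (-((k : ℝ) - 1 / 2)) := by
  have hr : (k : ℝ) - 1 / 2 ≠ 0 := by
    intro h
    have : (2 * k : ℝ) = 1 := by linarith
    have : 2 * k = 1 := by exact_mod_cast this
    omega
  have h := mul_iteratedDeriv_normalizedSinc_add (2 * m) (-((k : ℝ) - 1 / 2))
  have h0 := mul_iteratedDeriv_normalizedSinc_add 0 (-((k : ℝ) - 1 / 2))
  rw [sin_add_two_mul_pi_div_two] at h
  simp only [Nat.cast_zero, zero_mul, add_zero, pow_zero] at h0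
  rw [coeffA, mul_div_assoc, ← mul_assoc ((-1 : ℝ) ^ (k + 1)), neg_one_zpow_mul_self, one_mul,
    ← neg_sub (k : ℝ) (1 / 2), mul_div_assoc', div_eq_iff hr]
  push_cast at h
  linear_combination h - (-1) ^ m * Real.pi ^ (2 * m) * h0

theorem normalizedSinc_neg_intCast {k : ℤ} (hk : k ≠ 0) : normalizedSinc (-(k : ℝ)) = 0 := by
  have hk' : (k : ℝ) ≠ 0 := by exact_mod_cast hk
  have h := mul_normalizedSinc (-(k : ℝ))
  rw [show Real.pi * -(k : ℝ) = ((-k : ℤ) : ℝ) * Real.pi by push_cast; ring,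
    Real.sin_int_mul_pi, zero_div] at h
  exact (mul_eq_zero.1 h).resolve_left (neg_ne_zero.2 hk')

theorem iteratedDeriv_normalizedSinc_zero_of_odd (m : ℕ) :
    iteratedDeriv (2 * m + 1) normalizedSinc 0 = 0 := by
  have h := mul_iteratedDeriv_normalizedSinc_add (2 * (m + 1)) 0
  rw [sin_add_two_mul_pi_div_two, mul_zero, Real.sin_zero, mul_zero, mul_zero, zero_mul,
    zero_add] at h
  exact (mul_eq_zero.1 h).resolve_left (by positivity)

/-- As for `coeffA_term_eq`, with orders `2m+1` and 1. The extra term `sinc(-k)` vanishes for `k ≠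
0`. -/
theorem coeffB_term_eq (m : ℕ) (k : ℤ) :
    (2 * (m : ℝ) + 1) * ((-1) ^ (k + 1) * (coeffB m k / (k : ℝ))) =
      iteratedDeriv (2 * m + 1) normalizedSinc (-((k : ℝ) - 0)) -
        (-1) ^ m * Real.pi ^ (2 * m) * iteratedDeriv 1 normalizedSinc (-((k : ℝ) - 0)) := by
  rw [sub_zero]
  by_cases hk : k = 0
  -- Division by zero makes the left side 0 whatever `coeffB m 0` is; on the right, odd derivatives
  -- of sinc vanish at 0.
  · subst hk
    have := iteratedDeriv_normalizedSinc_zero_of_odd 0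
    simp only [mul_zero, zero_add] at this
    rw [Int.cast_zero, neg_zero, iteratedDeriv_normalizedSinc_zero_of_odd, this]
    simp
  · have hr : (k : ℝ) ≠ 0 := by exact_mod_cast hk
    have h := mul_iteratedDeriv_normalizedSinc_add (2 * m + 1) (-(k : ℝ))
    have h0 := mul_iteratedDeriv_normalizedSinc_add 1 (-(k : ℝ))
    rw [show Real.pi * -(k : ℝ) + ((2 * m + 1 : ℕ) : ℝ) * (Real.pi / 2) =
      (Real.pi * -(k : ℝ) + ((1 : ℕ) : ℝ) * (Real.pi / 2)) + (2 * m : ℕ) * (Real.pi / 2) by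
        push_cast; ring, sin_add_two_mul_pi_div_two] at h
    simp only [Nat.add_sub_cancel, Nat.sub_self, iteratedDeriv_zero, pow_one,
      normalizedSinc_neg_intCast hk] at h h0
    rw [coeffB, if_neg hk, mul_div_assoc, ← mul_assoc ((-1 : ℝ) ^ (k + 1)),
      neg_one_zpow_mul_self, one_mul, mul_div_assoc', div_eq_iff hr]
    rw [pow_succ] at h
    push_cast at h h0
    linear_combination h - (-1) ^ m * Real.pi ^ (2 * m) * h0

theorem I_pow_two_mul (m : ℕ) : Complex.I ^ (2 * m) = (-1) ^ m := by
  rw [pow_mul, Complex.I_sq]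

theorem hasSum_coeffA_exp {m : ℕ} (hm : 1 ≤ m) {v : ℝ} (hv : |v| ≤ 1 / 2) :
    HasSum (fun k : ℤ =>
      ((2 * (m : ℝ) * ((-1) ^ (k + 1) * (coeffA m k / ((k : ℝ) - 1 / 2))) : ℝ) : ℂ) *
        Complex.exp (2 * Real.pi * Complex.I * v * ((k : ℝ) - 1 / 2 : ℝ)))
      ((2 * Real.pi * Complex.I * v) ^ (2 * m) -
        (((-1) ^ m * Real.pi ^ (2 * m) : ℝ) : ℂ) * (2 * Real.pi * Complex.I * v) ^ 0) := by
  refine hasSum_exp_of_endpoints_eq_zero ?_ (coeffA_term_eq m) ?_ ?_ hv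
  · refine Summable.mul_left _ (summable_of_isBigO_inv_abs_cube ?_)
    refine (IsBigO.of_norm_left ?_).trans (coeffA_div_isBigO hm)
    simp_rw [Real.norm_eq_abs, abs_neg_one_zpow_mul]
    exact (isBigO_refl _ _).norm_left
  · rw [mul_pow, I_pow_two_mul]
    push_cast
    ring
  · rw [Even.neg_pow (even_two_mul m), mul_pow, I_pow_two_mul]
    push_cast
    ring

theorem hasSum_coeffB_exp (m : ℕ) {v : ℝ} (hv : |v| ≤ 1 / 2) :
    HasSum (fun k : ℤ =>
      (((2 * (m : ℝ) + 1) * ((-1) ^ (k + 1) * (coeffB m k / (k : ℝ))) : ℝ) : ℂ) *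
        Complex.exp (2 * Real.pi * Complex.I * v * ((k : ℝ) - 0 : ℝ)))
      ((2 * Real.pi * Complex.I * v) ^ (2 * m + 1) -
        (((-1) ^ m * Real.pi ^ (2 * m) : ℝ) : ℂ) * (2 * Real.pi * Complex.I * v) ^ 1) := by
  refine hasSum_exp_of_endpoints_eq_zero ?_ (coeffB_term_eq m) ?_ ?_ hv
  · refine Summable.mul_left _ (summable_of_isBigO_inv_abs_cube ?_)
    refine (IsBigO.of_norm_left ?_).trans (coeffB_div_isBigO m)
    simp_rw [Real.norm_eq_abs, abs_neg_one_zpow_mul]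
    exact (isBigO_refl _ _).norm_left
  · rw [pow_succ, mul_pow, I_pow_two_mul]
    push_cast
    ring
  · rw [pow_succ, Even.neg_pow (even_two_mul m), mul_pow, I_pow_two_mul]
    push_cast
    ring

/-! ### Convolution of a bounded function with a test function -/

theorem exists_forall_norm_le_of_memLp_top {f : ℝ → ℂ} (hc : Continuous f)
    (hf : MemLp f ⊤ volume) : ∃ M : ℝ, 0 ≤ M ∧ ∀ x, ‖f x‖ ≤ M := by
  have h := hf.2.ne
  rw [eLpNorm_exponent_top] at h
  refine ⟨(eLpNormEssSup f volume).toReal, ENNReal.toReal_nonneg, ?_⟩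
  have hae : ∀ᵐ x, ‖f x‖ ≤ (eLpNormEssSup f volume).toReal := by
    filter_upwards [ae_le_eLpNormEssSup (f := f) (μ := volume)] with x hx
    rw [← toReal_enorm]
    exact ENNReal.toReal_mono h hx
  have hd := Measure.dense_of_ae hae
  have hcl : IsClosed {x | ‖f x‖ ≤ (eLpNormEssSup f volume).toReal} :=
    isClosed_le hc.norm continuous_const
  intro x
  have : x ∈ closure {x | ‖f x‖ ≤ (eLpNormEssSup f volume).toReal} := hd x
  rwa [hcl.closure_eq] at this

theorem integrable_mul_schwartz_sub {f : ℝ → ℂ} (hc : Continuous f) {M : ℝ}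
    (hM : ∀ x, ‖f x‖ ≤ M) (φ : 𝓢(ℝ, ℂ)) (t : ℝ) : Integrable (fun x => f x * φ (t - x)) :=
  (φ.integrable.comp_sub_left t).bdd_mul hc.aestronglyMeasurable (ae_of_all _ hM)

theorem hasDerivAt_integral_mul_schwartz_sub {f : ℝ → ℂ} (hc : Continuous f) {M : ℝ}
    (hM : ∀ x, ‖f x‖ ≤ M) (φ : 𝓢(ℝ, ℂ)) (t : ℝ) :
    HasDerivAt (fun t => ∫ x, f x * φ (t - x))
      (∫ x, f x * (derivCLM ℂ ℂ φ) (t - x)) t := by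
  obtain ⟨C, hC⟩ : ∃ C : ℝ, ∀ y, (1 + ‖y‖) ^ 2 * ‖(derivCLM ℂ ℂ φ) y‖ ≤ C :=
    ⟨_, fun y => by
      simpa using SchwartzMap.one_add_le_sup_seminorm_apply (𝕜 := ℂ) (m := (2, 0)) le_rfl le_rfl
        (derivCLM ℂ ℂ φ) y⟩
  have hM0 : 0 ≤ M := (norm_nonneg _).trans (hM 0)
  refine (hasDerivAt_integral_of_dominated_loc_of_deriv_le (s := Metric.ball t 1)
    -- The 4 is the square of the 2 in `1 + ‖t - x‖ ≤ 2 (1 + ‖s - x‖)`, valid for `s` within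
    -- distance 1 of `t`.
    (bound := fun x => M * (4 * C) * (1 + ‖t - x‖) ^ (-2 : ℝ))
    (F := fun t x => f x * φ (t - x)) (F' := fun t x => f x * (derivCLM ℂ ℂ φ) (t - x))
    (Metric.ball_mem_nhds t one_pos)
    (Eventually.of_forall fun s => (integrable_mul_schwartz_sub hc hM φ s).aestronglyMeasurable)
    (integrable_mul_schwartz_sub hc hM φ t)
    (integrable_mul_schwartz_sub hc hM _ t).aestronglyMeasurable ?_ ?_ ?_).2
  · refine ae_of_all _ fun x s hs => ?_
    rw [norm_mul, mul_assoc]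
    refine mul_le_mul (hM x) ?_ (norm_nonneg _) hM0
    have h1 : 0 < 1 + ‖t - x‖ := by positivity
    have h2 : 1 + ‖t - x‖ ≤ 2 * (1 + ‖s - x‖) := by
      have h3 : ‖t - x‖ ≤ ‖t - s‖ + ‖s - x‖ := norm_sub_le_norm_sub_add_norm_sub t s x
      have h4 : ‖t - s‖ < 1 := by rwa [← dist_eq_norm, dist_comm]
      have := norm_nonneg (s - x)
      linarith
    rw [Real.rpow_neg h1.le, ← div_eq_mul_inv, le_div_iff₀ (by positivity)]
    norm_cast
    have h5 : (1 + ‖t - x‖) ^ 2 ≤ 4 * (1 + ‖s - x‖) ^ 2 := by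
      have := pow_le_pow_left₀ h1.le h2 2
      linarith [mul_pow 2 (1 + ‖s - x‖) 2]
    calc _ ≤ ‖(derivCLM ℂ ℂ φ) (s - x)‖ * (4 * (1 + ‖s - x‖) ^ 2) := by gcongr
      _ = 4 * ((1 + ‖s - x‖) ^ 2 * ‖(derivCLM ℂ ℂ φ) (s - x)‖) := by ring
      _ ≤ _ := by gcongr; exact hC _
  · exact ((integrable_one_add_norm (E := ℝ) (μ := volume) (r := 2)
      (by norm_num)).comp_sub_left t).const_mul _
  · refine ae_of_all _ fun x s _ => ?_
    have h := (φ.differentiableAt (x := s - x)).hasDerivAt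
    exact (h.comp_sub_const s x).const_mul (f x)

theorem iteratedDeriv_integral_mul_schwartz_sub {f : ℝ → ℂ} (hc : Continuous f) {M : ℝ}
    (hM : ∀ x, ‖f x‖ ≤ M) (n : ℕ) : ∀ (φ : 𝓢(ℝ, ℂ)) (t : ℝ),
    Integrable (fun x => f x * iteratedDeriv n φ (t - x)) ∧
    iteratedDeriv n (fun t => ∫ x, f x * φ (t - x)) t =
      ∫ x, f x * iteratedDeriv n φ (t - x) := by
  induction n with
  | zero => exact fun φ t => ⟨by simpa using integrable_mul_schwartz_sub hc hM φ t, by simp⟩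
  | succ n ih =>
    intro φ t
    have h : deriv φ = derivCLM ℂ ℂ φ := by ext x; simp
    rw [iteratedDeriv_succ', iteratedDeriv_succ', h,
      funext fun t => (hasDerivAt_integral_mul_schwartz_sub hc hM φ t).deriv]
    exact ih _ t

/-! ### Reproducing formula -/

theorem fourier_comp_neg_of_even {g : ℝ → ℂ} (hg : ∀ x, g (-x) = g x) (s : ℝ) :
    𝓕 g (-s) = 𝓕 g s := by
  rw [← Real.fourierInv_eq_fourier_neg, Real.fourierInv_eq_fourier_comp_neg]
  simp_rw [hg]

/-- A bounded function with Fourier transform supported in `[-σ/(2π), σ/(2π)]` annihilates the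
difference of a test function and its convolution with `𝓕 χ`, if `χ = 1` near that interval. -/
theorem integral_mul_eq_integral_mul_convolution {σ : ℝ} {f : ℝ → ℂ}
    (hf : f ∈ BernsteinSpace ⊤ σ) (χ : 𝓢(ℝ, ℂ)) {ρ : ℝ} (hρ : σ / (2 * Real.pi) < ρ)
    (hχ : ∀ x, |x| < ρ → χ x = 1) (θ : 𝓢(ℝ, ℂ)) :
    ∫ x, θ x * f x =
      ∫ x, SchwartzMap.convolution (ContinuousLinearMap.mul ℂ ℂ) (𝓕 χ) θ x * f x := by
  obtain ⟨_, hLp, hvan⟩ := hf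
  let ψ := SchwartzMap.convolution (ContinuousLinearMap.mul ℂ ℂ) (𝓕 χ) θ
  have hψ : ∀ x, (𝓕⁻ ψ) x = χ x * (𝓕⁻ θ) x := by
    intro x
    have h : ∀ η : 𝓢(ℝ, ℂ), (𝓕⁻ η) x = (𝓕 η) (-x) := fun η => rfl
    rw [h, h, SchwartzMap.fourier_convolution, SchwartzMap.pairing_apply_apply, ← h (𝓕 χ),
      FourierTransform.fourierInv_fourier_eq]
    rfl
  have hsupp : tsupport (𝓕⁻ θ - 𝓕⁻ ψ : 𝓢(ℝ, ℂ)) ⊆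
      (Set.Icc (-(σ / (2 * Real.pi))) (σ / (2 * Real.pi)))ᶜ := by
    -- The strict gap `σ/(2π) < ρ` keeps the closed support, not just the nonvanishing set, off the
    -- spectral interval.
    have h1 : tsupport (𝓕⁻ θ - 𝓕⁻ ψ : 𝓢(ℝ, ℂ)) ⊆ {x | ρ ≤ |x|} := by
      refine closure_minimal (fun x hx => ?_) (isClosed_le continuous_const continuous_abs)
      by_contra hlt
      refine hx ?_
      rw [sub_apply, hψ, hχ x (not_le.1 hlt), one_mul, sub_self]
    refine h1.trans fun x hx hx' => ?_
    exact absurd (hρ.trans_le hx) (not_lt.2 (abs_le.2 hx'))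
  have h := hvan _ hsupp
  have hsub : 𝓕 (𝓕⁻ θ - 𝓕⁻ ψ) = 𝓕 (𝓕⁻ θ) - 𝓕 (𝓕⁻ ψ) :=
    map_sub (FourierTransform.fourierCLM ℂ 𝓢(ℝ, ℂ)) _ _
  rw [TemperedDistribution.fourier_apply, hsub,
    FourierTransform.fourier_fourierInv_eq, FourierTransform.fourier_fourierInv_eq,
    Lp.toTemperedDistribution_apply] at h
  have hint : ∀ η : 𝓢(ℝ, ℂ), Integrable (fun x => η x * f x) := fun η =>
    η.integrable.mul_of_top_left hLp
  have h2 : ∫ x, (θ x * f x - ψ x * f x) = 0 := by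
    rw [← h]
    refine integral_congr_ae ?_
    filter_upwards [hLp.coeFn_toLp] with x hx
    rw [hx, sub_apply, smul_eq_mul, sub_mul]
  rw [integral_sub (hint θ) (hint ψ)] at h2
  exact sub_eq_zero.1 h2

/-- Reproducing formula for functions of the Bernstein space. -/
theorem eq_integral_mul_fourier_sub {σ : ℝ} {f : ℝ → ℂ} (hf : f ∈ BernsteinSpace ⊤ σ)
    {M : ℝ} (hM : ∀ x, ‖f x‖ ≤ M)
    (χ : 𝓢(ℝ, ℂ)) {ρ : ℝ} (hρ : σ / (2 * Real.pi) < ρ) (hχ : ∀ x, |x| < ρ → χ x = 1)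
    (heven : ∀ x, χ (-x) = χ x) (t : ℝ) :
    f t = ∫ x, f x * (𝓕 χ) (t - x) := by
  have hc : Continuous f := hf.1.continuous
  have hg : Continuous (fun t => ∫ x, f x * (𝓕 χ) (t - x)) :=
    continuous_iff_continuousAt.2 fun t =>
      (hasDerivAt_integral_mul_schwartz_sub hc hM (𝓕 χ) t).continuousAt
  -- Evenness of `𝓕 χ` allows the convolution to be moved from the test function onto `f`.
  have hφ : ∀ x y, (𝓕 χ) (x - y) = (𝓕 χ) (y - x) := fun x y => by
    rw [← neg_sub y x]
    exact fourier_comp_neg_of_even heven _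
  refine congrFun ((Continuous.ae_eq_iff_eq volume hc hg).1 ?_) t
  refine ae_eq_of_integral_contDiff_smul_eq hc.locallyIntegrable hg.locallyIntegrable
    fun g g_diff g_supp => ?_
  have hs : HasCompactSupport (fun x => (g x : ℂ)) := g_supp.comp_left Complex.ofReal_zero
  let θ : 𝓢(ℝ, ℂ) := hs.toSchwartzMap (Complex.ofRealCLM.contDiff.comp g_diff)
  have hθ : ∀ x, θ x = (g x : ℂ) := fun _ => rfl
  have key := integral_mul_eq_integral_mul_convolution hf χ hρ hχ θ
  have hI : Integrable (fun p : ℝ × ℝ => (θ p.2 * (𝓕 χ) (p.1 - p.2)) * f p.1) (volume.prod volume) :=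
    (θ.integrable.convolution_integrand (ContinuousLinearMap.mul ℂ ℂ) (𝓕 χ).integrable).mul_bdd
      (hc.comp continuous_fst).aestronglyMeasurable (ae_of_all _ fun p => hM p.1)
  have hfub := calc ∫ x, (g x : ℂ) * f x = ∫ x, θ x * f x := by simp [hθ]
    _ = ∫ x, ∫ y, (θ y * (𝓕 χ) (x - y)) * f x := by
      rw [key]
      congr 1
      ext x
      rw [SchwartzMap.convolution_apply, convolution_eq_swap, ← integral_mul_const]
      congr 1
      ext y
      simp [mul_comm]
    _ = ∫ y, ∫ x, (θ y * (𝓕 χ) (x - y)) * f x := integral_integral_swap hI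
    _ = ∫ y, (g y : ℂ) * ∫ x, f x * (𝓕 χ) (y - x) := by
      congr 1
      ext y
      rw [← integral_const_mul]
      congr 1
      ext x
      rw [hφ x y, hθ]
      ring
  simpa only [Complex.real_smul] using hfub

/-! ### Transfer of an exponential expansion to band-limited functions -/

theorem integrable_pow_smul_schwartz (χ : 𝓢(ℝ, ℂ)) (n : ℕ) :
    Integrable (fun x : ℝ => x ^ n • χ x) := by
  refine (χ.integrable_pow_mul volume n).mono' (by fun_prop) (ae_of_all _ fun x => ?_)
  rw [norm_smul, norm_pow]

theorem integrable_exp_mul_pow_mul_schwartz (χ : 𝓢(ℝ, ℂ)) (n : ℕ) (s : ℝ) (c : ℂ) :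
    Integrable (fun ξ : ℝ => Complex.exp (↑(-2 * Real.pi * ξ * s) * Complex.I) *
      ((c * ξ) ^ n * χ ξ)) := by
  refine Integrable.bdd_mul (c := 1) ?_ (Continuous.aestronglyMeasurable (by fun_prop))
    (ae_of_all _ fun ξ => (Complex.norm_exp_ofReal_mul_I _).le)
  have := (integrable_pow_smul_schwartz χ n).const_mul (c ^ n)
  refine this.congr (ae_of_all _ fun ξ => ?_)
  simp only [Complex.real_smul, mul_pow]
  push_cast
  ring

theorem iteratedDeriv_fourier_schwartz (χ : 𝓢(ℝ, ℂ)) (n : ℕ) (s : ℝ) :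
    iteratedDeriv n (𝓕 χ : 𝓢(ℝ, ℂ)) s = ∫ ξ : ℝ, Complex.exp (↑(-2 * Real.pi * ξ * s) * Complex.I) *
      ((-2 * Real.pi * Complex.I * ξ) ^ n * χ ξ) := by
  rw [SchwartzMap.fourier_coe, Real.iteratedDeriv_fourier (N := ⊤)
    (fun n _ => integrable_pow_smul_schwartz χ n) le_top, Real.fourier_real_eq_integral_exp_smul]
  simp only [smul_eq_mul]

/-- An exponential expansion on `[-1/2, 1/2]` yields a differentiation formula for the Fourier
transform of a test function supported in `[-σ/(2π), σ/(2π)]`. -/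
theorem hasSum_mul_fourier_schwartz_of_hasSum_exp {σ : ℝ} (hσ : 0 < σ) {n j : ℕ} {b : ℂ}
    {d : ℤ → ℂ} {r : ℤ → ℝ} (hd : Summable d)
    (hexp : ∀ v : ℝ, |v| ≤ 1 / 2 →
      HasSum (fun k => d k * Complex.exp (2 * Real.pi * Complex.I * v * r k))
        ((2 * Real.pi * Complex.I * v) ^ n - b * (2 * Real.pi * Complex.I * v) ^ j))
    (χ : 𝓢(ℝ, ℂ)) (hχ : ∀ ξ, σ / (2 * Real.pi) < |ξ| → χ ξ = 0) (s : ℝ) :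
    HasSum (fun k => d k * (𝓕 χ) (s + Real.pi / σ * r k))
      ((Real.pi / σ : ℂ) ^ n * iteratedDeriv n (𝓕 χ : 𝓢(ℝ, ℂ)) s -
        b * ((Real.pi / σ : ℂ) ^ j * iteratedDeriv j (𝓕 χ : 𝓢(ℝ, ℂ)) s)) := by
  let F : ℤ → ℝ → ℂ := fun k ξ => d k *
    (Complex.exp (↑(-2 * Real.pi * ξ * (s + Real.pi / σ * r k)) * Complex.I) * χ ξ)
  have hFnorm : ∀ k ξ, ‖F k ξ‖ = ‖d k‖ * ‖χ ξ‖ := fun k ξ => by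
    simp only [F, norm_mul, Complex.norm_exp_ofReal_mul_I, one_mul]
  have hFint : ∀ k, Integrable (F k) := fun k => by
    refine (Integrable.bdd_mul (c := 1) χ.integrable (Continuous.aestronglyMeasurable (by fun_prop))
      (ae_of_all _ fun ξ => (Complex.norm_exp_ofReal_mul_I _).le)).const_mul (d k)
  have hFsum : Summable fun k => ∫ ξ, ‖F k ξ‖ := by
    simp only [hFnorm, integral_const_mul]
    exact hd.norm.mul_right _
  have key := hasSum_integral_of_summable_integral_norm hFint hFsum
  have hpt : ∀ ξ, HasSum (fun k => F k ξ) (Complex.exp (↑(-2 * Real.pi * ξ * s) * Complex.I) *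
      (((-2 * Real.pi * Complex.I * (Real.pi / σ)) * ξ) ^ n * χ ξ) -
      b * (Complex.exp (↑(-2 * Real.pi * ξ * s) * Complex.I) *
      (((-2 * Real.pi * Complex.I * (Real.pi / σ)) * ξ) ^ j * χ ξ))) := by
    intro ξ
    by_cases hξ : σ / (2 * Real.pi) < |ξ|
    · simp only [F, hχ ξ hξ, mul_zero, sub_zero]
      exact hasSum_zero
    -- The expansion is used at `v = -πξ/σ`, which lies in the band exactly where `χ` may be
    -- nonzero.
    · have hv : |-(Real.pi / σ * ξ)| ≤ 1 / 2 := by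
        rw [abs_neg, abs_mul, abs_of_pos (div_pos Real.pi_pos hσ)]
        have h1 := mul_le_mul_of_nonneg_left (not_lt.1 hξ) (div_pos Real.pi_pos hσ).le
        have h2 : Real.pi / σ * (σ / (2 * Real.pi)) = 1 / 2 := by
          field_simp
        rwa [h2] at h1
      have h := (hexp _ hv).mul_left
        (Complex.exp (↑(-2 * Real.pi * ξ * s) * Complex.I) * χ ξ)
      convert! h using 1
      · ext k
        simp only [F]
        have : Complex.exp (↑(-2 * Real.pi * ξ * (s + Real.pi / σ * r k)) * Complex.I) =
            Complex.exp (↑(-2 * Real.pi * ξ * s) * Complex.I) *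
            Complex.exp (2 * Real.pi * Complex.I * (-(Real.pi / σ * ξ) : ℝ) * r k) := by
          rw [← Complex.exp_add]
          congr 1
          push_cast
          ring
        rw [this]
        ring
      · have : -2 * Real.pi * Complex.I * (Real.pi / σ) * ξ =
            2 * Real.pi * Complex.I * (-(Real.pi / σ * ξ) : ℝ) := by
          push_cast
          ring
        rw [this]
        ring
  have hR : ∀ i : ℕ, ∫ ξ : ℝ, Complex.exp (↑(-2 * Real.pi * ξ * s) * Complex.I) *
      (((-2 * Real.pi * Complex.I * (Real.pi / σ)) * ξ) ^ i * χ ξ) =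
      (Real.pi / σ : ℂ) ^ i * iteratedDeriv i (𝓕 χ : 𝓢(ℝ, ℂ)) s := by
    intro i
    rw [iteratedDeriv_fourier_schwartz, ← integral_const_mul]
    congr 1
    ext ξ
    rw [mul_right_comm _ _ (ξ : ℂ), mul_pow _ (Real.pi / σ : ℂ)]
    ring
  have hL : ∀ k, ∫ ξ, F k ξ = d k * (𝓕 χ) (s + Real.pi / σ * r k) := by
    intro k
    rw [integral_const_mul, SchwartzMap.fourier_coe, Real.fourier_real_eq_integral_exp_smul]
    simp only [smul_eq_mul]
  simp only [hL, fun ξ => (hpt ξ).tsum_eq] at key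
  rw [integral_sub (integrable_exp_mul_pow_mul_schwartz χ n s _)
    ((integrable_exp_mul_pow_mul_schwartz χ j s _).const_mul b), integral_const_mul, hR, hR] at key
  exact key

/-- Existence of an even test function that equals `1` near `[-a, a]` and vanishes off
`[-c, c]`. -/
theorem exists_even_schwartz_eq_one {a c : ℝ} (ha : 0 < a) (hac : a < c) :
    ∃ χ : 𝓢(ℝ, ℂ), (∀ x, |x| < (a + c) / 2 → χ x = 1) ∧ (∀ x, c < |x| → χ x = 0) ∧
      ∀ x, χ (-x) = χ x := by
  -- The inner radius is the midpoint, leaving a margin beyond `a` where the function is still 1.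
  let g : ContDiffBump (0 : ℝ) := ⟨(a + c) / 2, c, by linarith, by linarith⟩
  have hs : HasCompactSupport (fun x => (g x : ℂ)) :=
    g.hasCompactSupport.comp_left Complex.ofReal_zero
  refine ⟨hs.toSchwartzMap (Complex.ofRealCLM.contDiff.comp g.contDiff), fun x hx => ?_,
    fun x hx => ?_, fun x => ?_⟩
  · change (g x : ℂ) = 1
    rw [g.one_of_mem_closedBall (by simpa using hx.le), Complex.ofReal_one]
  · change (g x : ℂ) = 0
    rw [g.zero_of_le_dist (by simpa using hx.le), Complex.ofReal_zero]
  · change (g (-x) : ℂ) = g x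
    rw [g.neg]

/-- The gap `σ₀ < σ` leaves room for a cutoff `χ` that is 1 near the spectrum of `f` and 0 off the
larger band; integrating the expansion of `𝓕 χ` against `f` then reproduces `f` and its derivatives.
-/
theorem hasSum_mul_of_lt_of_hasSum_exp {σ₀ σ : ℝ} (hσ₀ : 0 < σ₀) (hσ : σ₀ < σ) {n j : ℕ} {b : ℂ}
    {d : ℤ → ℂ} {r : ℤ → ℝ} (hd : Summable d)
    (hexp : ∀ v : ℝ, |v| ≤ 1 / 2 →
      HasSum (fun k => d k * Complex.exp (2 * Real.pi * Complex.I * v * r k))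
        ((2 * Real.pi * Complex.I * v) ^ n - b * (2 * Real.pi * Complex.I * v) ^ j))
    {f : ℝ → ℂ} (hf : f ∈ BernsteinSpace ⊤ σ₀) (t : ℝ) :
    HasSum (fun k => d k * f (t + Real.pi / σ * r k))
      ((Real.pi / σ : ℂ) ^ n * iteratedDeriv n f t -
        b * ((Real.pi / σ : ℂ) ^ j * iteratedDeriv j f t)) := by
  have hc : Continuous f := hf.1.continuous
  obtain ⟨M, hM0, hM⟩ := exists_forall_norm_le_of_memLp_top hc hf.2.choose
  have h2π : 0 < 2 * Real.pi := Real.two_pi_pos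
  have hlt : σ₀ / (2 * Real.pi) < σ / (2 * Real.pi) := div_lt_div_of_pos_right hσ h2π
  obtain ⟨χ, hχ1, hχ0, hχe⟩ := exists_even_schwartz_eq_one (div_pos hσ₀ h2π) hlt
  have hrep : ∀ s, f s = ∫ x, f x * (𝓕 χ) (s - x) :=
    eq_integral_mul_fourier_sub hf hM χ (by linarith) hχ1 hχe
  have hder : ∀ i : ℕ, iteratedDeriv i f t = ∫ x, f x * iteratedDeriv i (𝓕 χ : 𝓢(ℝ, ℂ)) (t - x) :=
    fun i => by
      conv_lhs => rw [funext hrep]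
      exact (iteratedDeriv_integral_mul_schwartz_sub hc hM i (𝓕 χ) t).2
  have hderI : ∀ i : ℕ, Integrable fun x => f x * iteratedDeriv i (𝓕 χ : 𝓢(ℝ, ℂ)) (t - x) :=
    fun i => (iteratedDeriv_integral_mul_schwartz_sub hc hM i (𝓕 χ) t).1
  let F : ℤ → ℝ → ℂ := fun k x => d k * (f x * (𝓕 χ) (t + Real.pi / σ * r k - x))
  have hFint : ∀ k, Integrable (F k) := fun k =>
    (integrable_mul_schwartz_sub hc hM (𝓕 χ) _).const_mul _
  have hFsum : Summable fun k => ∫ x, ‖F k x‖ := by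
    refine Summable.of_nonneg_of_le (fun k => integral_nonneg fun x => norm_nonneg _)
      (fun k => ?_) (hd.norm.mul_right (M * ∫ x, ‖(𝓕 χ) x‖))
    calc ∫ x, ‖F k x‖ ≤ ∫ x, ‖d k‖ * (M * ‖(𝓕 χ) (t + Real.pi / σ * r k - x)‖) := by
          refine integral_mono (hFint k).norm
            ((((𝓕 χ).integrable.comp_sub_left _).norm.const_mul M).const_mul ‖d k‖) fun x => ?_
          simp only [F, norm_mul]
          gcongr
          exact hM x
      _ = _ := by
          rw [integral_const_mul, integral_const_mul,
            integral_sub_left_eq_self (fun x => ‖(𝓕 χ : 𝓢(ℝ, ℂ)) x‖) volume]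
  have key := hasSum_integral_of_summable_integral_norm hFint hFsum
  have hpt : ∀ x, HasSum (fun k => F k x)
      ((Real.pi / σ : ℂ) ^ n * (f x * iteratedDeriv n (𝓕 χ : 𝓢(ℝ, ℂ)) (t - x)) -
        b * ((Real.pi / σ : ℂ) ^ j * (f x * iteratedDeriv j (𝓕 χ : 𝓢(ℝ, ℂ)) (t - x)))) := by
    intro x
    have h := (hasSum_mul_fourier_schwartz_of_hasSum_exp (hσ₀.trans hσ) hd hexp χ hχ0
      (t - x)).mul_left (f x)
    convert! h using 1
    · ext k
      simp only [F]
      rw [sub_add_eq_add_sub]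
      ring
    · ring
  have hL : ∀ k, ∫ x, F k x = d k * f (t + Real.pi / σ * r k) := fun k => by
    rw [hrep, integral_const_mul]
  simp only [hL, fun x => (hpt x).tsum_eq] at key
  rw [integral_sub ((hderI n).const_mul _) (((hderI j).const_mul _).const_mul _),
    integral_const_mul, integral_const_mul, integral_const_mul, ← hder, ← hder] at key
  exact key

/-- An exponential expansion on `[-1/2, 1/2]` yields a differentiation formula on the Bernstein
space. -/
theorem hasSum_mul_of_hasSum_exp {σ : ℝ} (hσ : 0 < σ) {n j : ℕ} {b : ℂ}
    {d : ℤ → ℂ} {r : ℤ → ℝ} (hd : Summable d)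
    (hexp : ∀ v : ℝ, |v| ≤ 1 / 2 →
      HasSum (fun k => d k * Complex.exp (2 * Real.pi * Complex.I * v * r k))
        ((2 * Real.pi * Complex.I * v) ^ n - b * (2 * Real.pi * Complex.I * v) ^ j))
    {f : ℝ → ℂ} (hf : f ∈ BernsteinSpace ⊤ σ) (t : ℝ) :
    HasSum (fun k => d k * f (t + Real.pi / σ * r k))
      ((Real.pi / σ : ℂ) ^ n * iteratedDeriv n f t -
        b * ((Real.pi / σ : ℂ) ^ j * iteratedDeriv j f t)) := by
  have hc : Continuous f := hf.1.continuous
  obtain ⟨M, hM0, hM⟩ := exists_forall_norm_le_of_memLp_top hc hf.2.choose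
  have hle : ∀ k (τ : ℝ), ‖d k * f (t + Real.pi / τ * r k)‖ ≤ ‖d k‖ * M := fun k τ => by
    rw [norm_mul]
    exact mul_le_mul_of_nonneg_left (hM _) (norm_nonneg _)
  have hsum : Summable fun k => d k * f (t + Real.pi / σ * r k) :=
    Summable.of_norm_bounded (hd.norm.mul_right M) fun k => hle k σ
  refine hsum.hasSum_iff.2 ?_
  have hinv : ContinuousOn (fun τ : ℝ => Real.pi / τ) (Set.Ioi 0) :=
    continuousOn_const.div continuousOn_id fun τ hτ => (Set.mem_Ioi.1 hτ).ne'
  have hinv' : ContinuousOn (fun τ : ℝ => (Real.pi / τ : ℂ)) (Set.Ioi 0) := by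
    have := Complex.continuous_ofReal.comp_continuousOn hinv
    simpa [Function.comp_def] using this
  have hLc : ContinuousOn (fun τ : ℝ => ∑' k, d k * f (t + Real.pi / τ * r k)) (Set.Ioi 0) := by
    refine continuousOn_tsum (fun k => ?_) (hd.norm.mul_right M) fun k τ _ => hle k τ
    exact continuousOn_const.mul (hc.comp_continuousOn
      (continuousOn_const.add (hinv.mul continuousOn_const)))
  have hRc : ContinuousOn (fun τ : ℝ => (Real.pi / τ : ℂ) ^ n * iteratedDeriv n f t -
        b * ((Real.pi / τ : ℂ) ^ j * iteratedDeriv j f t)) (Set.Ioi 0) :=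
    ((hinv'.pow n).mul continuousOn_const).sub
      (continuousOn_const.mul ((hinv'.pow j).mul continuousOn_const))
  have hmem : Set.Ioi (0 : ℝ) ∈ nhds σ := Ioi_mem_nhds hσ
  -- With `f` fixed, both sides are continuous in `τ > 0` and agree for `τ > σ`, hence also at `σ`.
  refine tendsto_nhds_unique_of_eventuallyEq
    ((hLc.continuousAt hmem).tendsto.mono_left nhdsWithin_le_nhds)
    ((hRc.continuousAt hmem).tendsto.mono_left (nhdsWithin_le_nhds (s := Set.Ioi σ))) ?_
  filter_upwards [self_mem_nhdsWithin] with τ hτ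
  exact (hasSum_mul_of_lt_of_hasSum_exp hσ hτ hd hexp hf t).tsum_eq

/-! ### The two differentiation formulas -/

theorem hasSum_coeffA_mul {σ : ℝ} (hσ : 0 < σ) {f : ℝ → ℂ} (hf : f ∈ BernsteinSpace ⊤ σ)
    {m : ℕ} (hm : 1 ≤ m) (t : ℝ) :
    HasSum (fun k : ℤ => (((-1) ^ (k + 1) * (coeffA m k / ((k : ℝ) - 1 / 2)) : ℝ) : ℂ) *
        f (t + Real.pi / σ * ((k : ℝ) - 1 / 2)))
      ((2 * (m : ℂ))⁻¹ * ((Real.pi / σ : ℂ) ^ (2 * m) * iteratedDeriv (2 * m) f t -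
        (-1) ^ m * Real.pi ^ (2 * m) * f t)) := by
  have hexp := fun (v : ℝ) (hv : |v| ≤ 1 / 2) => hasSum_coeffA_exp hm hv
  -- At `v = 0` all exponentials are 1, so the expansion itself gives summability of the
  -- coefficients.
  have hd := (hexp 0 (by norm_num)).summable
  simp only [Complex.ofReal_zero, mul_zero, zero_mul, Complex.exp_zero, mul_one] at hd
  have h := (hasSum_mul_of_hasSum_exp hσ hd hexp hf t).mul_left (2 * (m : ℂ))⁻¹
  have hm0 : (m : ℂ) ≠ 0 := by exact_mod_cast (by omega : m ≠ 0)
  convert! h using 1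
  · ext k
    rw [← mul_assoc, Complex.ofReal_mul (2 * (m : ℝ))]
    push_cast
    field_simp
  · simp

theorem hasSum_coeffB_mul {σ : ℝ} (hσ : 0 < σ) {f : ℝ → ℂ} (hf : f ∈ BernsteinSpace ⊤ σ)
    (m : ℕ) (t : ℝ) :
    HasSum (fun k : {k : ℤ // k ≠ 0} =>
        (((-1) ^ (k.1 + 1) * (coeffB m k.1 / (k.1 : ℝ)) : ℝ) : ℂ) *
          f (t + Real.pi * (k.1 : ℝ) / σ))
      ((2 * (m : ℂ) + 1)⁻¹ * ((Real.pi / σ : ℂ) ^ (2 * m + 1) * iteratedDeriv (2 * m + 1) f t -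
        (-1) ^ m * Real.pi ^ (2 * m) * (Real.pi / σ * deriv f t))) := by
  have hexp := fun (v : ℝ) (hv : |v| ≤ 1 / 2) => hasSum_coeffB_exp m hv
  have hd := (hexp 0 (by norm_num)).summable
  simp only [Complex.ofReal_zero, mul_zero, zero_mul, Complex.exp_zero, mul_one] at hd
  have h := (hasSum_mul_of_hasSum_exp hσ hd hexp hf t).mul_left (2 * (m : ℂ) + 1)⁻¹
  have hm0 : 2 * (m : ℂ) + 1 ≠ 0 := by exact_mod_cast (by omega : 2 * m + 1 ≠ 0)
  have hZ : HasSum (fun k : ℤ => (((-1) ^ (k + 1) * (coeffB m k / (k : ℝ)) : ℝ) : ℂ) *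
      f (t + Real.pi * (k : ℝ) / σ))
      ((2 * (m : ℂ) + 1)⁻¹ * ((Real.pi / σ : ℂ) ^ (2 * m + 1) * iteratedDeriv (2 * m + 1) f t -
        (-1) ^ m * Real.pi ^ (2 * m) * (Real.pi / σ * deriv f t))) := by
    convert! h using 1
    · ext k
      rw [← mul_assoc, Complex.ofReal_mul (2 * (m : ℝ) + 1), sub_zero, div_mul_eq_mul_div]
      push_cast
      field_simp
    · simp
  -- The `k = 0` term is a division by zero, hence 0, and can be dropped.
  refine (hasSum_subtype_iff_of_support_subset (s := {k : ℤ | k ≠ 0}) fun k hk hk0 => ?_).2 hZ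
  simp [hk0] at hk

theorem mainTheorem11 (σ : ℝ) (hσ : 0 < σ) (f : ℝ → ℂ) (hf : f ∈ BernsteinSpace ⊤ σ)
    (m : ℕ) (hm : 1 ≤ m) :
    -- the coefficients of both series are of order `O(k⁻³)`
    (fun k : ℤ => coeffA m k / ((k : ℝ) - 1 / 2)) =O[cofinite] (fun k : ℤ => (|(k : ℝ)| ^ 3)⁻¹) ∧
    (fun k : ℤ => coeffB m k / (k : ℝ)) =O[cofinite] (fun k : ℤ => (|(k : ℝ)| ^ 3)⁻¹) ∧
    ∀ t : ℝ,
      -- even derivatives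
      (Summable (fun k : ℤ => (((-1) ^ (k + 1) * (coeffA m k / ((k : ℝ) - 1 / 2)) : ℝ) : ℂ) *
          f (t + Real.pi / σ * ((k : ℝ) - 1 / 2))) ∧
        iteratedDeriv (2 * m) f t =
          (((-1) ^ m * σ ^ (2 * m) : ℝ) : ℂ) * f t +
          ((2 * (m : ℝ) * σ ^ (2 * m) / Real.pi ^ (2 * m) : ℝ) : ℂ) *
            ∑' k : ℤ, (((-1) ^ (k + 1) * (coeffA m k / ((k : ℝ) - 1 / 2)) : ℝ) : ℂ) *
              f (t + Real.pi / σ * ((k : ℝ) - 1 / 2))) ∧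
      -- odd derivatives
      (Summable (fun k : {k : ℤ // k ≠ 0} =>
          (((-1) ^ (k.1 + 1) * (coeffB m k.1 / (k.1 : ℝ)) : ℝ) : ℂ) *
            f (t + Real.pi * (k.1 : ℝ) / σ)) ∧
        iteratedDeriv (2 * m + 1) f t =
          ((-((2 * (m : ℝ) + 1) * σ ^ (2 * m) / Real.pi ^ (2 * m)) * coeffB m 0 : ℝ) : ℂ) *
            deriv f t +
          (((2 * (m : ℝ) + 1) * σ ^ (2 * m + 1) / Real.pi ^ (2 * m + 1) : ℝ) : ℂ) *
            ∑' k : {k : ℤ // k ≠ 0},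
              (((-1) ^ (k.1 + 1) * (coeffB m k.1 / (k.1 : ℝ)) : ℝ) : ℂ) *
                f (t + Real.pi * (k.1 : ℝ) / σ)) := by
  have hσ' : (σ : ℂ) ≠ 0 := by exact_mod_cast hσ.ne'
  have hπ : (Real.pi : ℂ) ≠ 0 := by exact_mod_cast Real.pi_ne_zero
  have hm0 : (m : ℂ) ≠ 0 := by exact_mod_cast (by omega : m ≠ 0)
  have hm1 : 2 * (m : ℂ) + 1 ≠ 0 := by exact_mod_cast (by omega : 2 * m + 1 ≠ 0)
  refine ⟨coeffA_div_isBigO hm, coeffB_div_isBigO m, fun t => ⟨⟨?_, ?_⟩, ?_, ?_⟩⟩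
  -- For complex series, `Summable` is equivalent to absolute convergence.
  · exact (hasSum_coeffA_mul hσ hf hm t).summable
  · rw [(hasSum_coeffA_mul hσ hf hm t).tsum_eq, div_pow]
    push_cast
    field_simp
    ring
  · exact (hasSum_coeffB_mul hσ hf m t).summable
  -- The value of `coeffB m 0` makes the coefficient of `f'` equal to `(-1)^m σ^(2m)`, the
  -- contribution of the subtracted linear term.
  · rw [(hasSum_coeffB_mul hσ hf m t).tsum_eq, coeffB, if_pos rfl, div_pow]
    push_cast
    field_simp
    ring
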